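/- Let $\Phi(\alpha,\tau)=\bigl(2\sqrt{\tau-\tau^2}\cos(2\pi\alpha),\,2\sqrt{\tau-\tau^2}\sin(2\pi\alpha),\,1-2\tau\bigr)$ be the Lambert equal-area map onto the unit sphere $\mathbb S^2$ (with $\tau\in[0,1]$ and $\alpha$ taken modulo $1$). Fix $u\in\mathbb R$ and $0<v<1/2$, and put $\boldsymbol w=\Phi(u,v)$. For $-1<t<1$ let $$F(\alpha,\tau)=F_t(\alpha,\tau)=\|\boldsymbol w-\Phi(\alpha,\tau)\|^2-2(1-t).$$ All curves below are considered in the open cylinder obtained from $[0,1]\times(0,1)$ by identifying the sides $\alpha=0$ and $\alpha=1$, represented by $[0,1)\times(0,1)$. The level curve with parameter $t$ is $\mathcal C_t=\{(\alpha,\tau)\in[0,1)\times(0,1): F_t(\alpha,\tau)=0\}$. Let $$\kappa=\frac{F_{\alpha\alpha}F_\tau^2-2F_{\alpha\tau}F_\alpha F_\tau+F_{\tau\tau}F_\alpha^2}{(F_\alpha^2+F_\tau^2)^{3/2}}$$ be the signed curvature at $(\alpha,\tau)$ of the level curve through $(\alpha,\tau)$ (it does not depend on $t$, and is defined where $F_\alpha^2+F_\tau^2\neq0$),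 and let $\mathcal Z=\{(\alpha,\tau)\in[0,1)\times(0,1): F_\alpha^2+F_\tau^2\ne 0,\ \kappa(\alpha,\tau)=0\}$ be the curve of zeros of the curvature. A symmetric pair is a set of two distinct points $(\alpha,\tau)$, $(\alpha',\tau)$ of $[0,1)\times(0,1)$ with $\alpha'\equiv 2u-\alpha \pmod 1$, that is, two points which are mirror images in the vertical line $\alpha=u$ of the cylinder. Then: 1. If $-(1-2v)\le t\le 1-2v$, then $\mathcal C_t\cap\mathcal Z$ consists of precisely one symmetric pair. 2. If $-1<t<-(1-2v)$ or $1-2v<t<1$, then one of the following holds: (a) $\mathcal C_t\cap\mathcal Z=\emptyset$; (b) $\mathcal C_t\cap\mathcal Z$ consists of precisely one symmetric pair, and at each of its two points $\mathcal C_t$ and $\mathcal Z$ are tangential, i.e. $F_t$ and $\kappa$ have nonzero gradients there and the two curves have the same tangent line; (c) $\mathcal C_t\cap\mathcal Z$ consists of precisely two disjoint symmetric pairs. -/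

import Mathlib

noncomputable section

/-- The Lambert cylindrical equal-area map from the parameter plane to the unit sphere in `ℝ³`.
(It is used for `τ ∈ [0, 1]`; it is `1`-periodic in `α`.) -/
def lambert (α τ : ℝ) : EuclideanSpace ℝ (Fin 3) :=
  !₂[2 * Real.sqrt (τ - τ ^ 2) * Real.cos (2 * Real.pi * α),
     2 * Real.sqrt (τ - τ ^ 2) * Real.sin (2 * Real.pi * α),
     1 - 2 * τ]

/-- The squared distance `‖w - z‖²` between `w = Φ(u, v)` and `z = Φ(α, τ)`. -/
def sqDist (u v α τ : ℝ) : ℝ := ‖lambert u v - lambert α τ‖ ^ 2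

/-- The function `F(α, τ) = ‖w - z‖² - 2 (1 - t)` whose zero set is the level curve of parameter
`t` of the distance function from `w = Φ(u, v)`. -/
def levelFun (u v t α τ : ℝ) : ℝ := sqDist u v α τ - 2 * (1 - t)

/-- Partial derivative in the first variable. -/
def pd₁ (G : ℝ → ℝ → ℝ) : ℝ → ℝ → ℝ := fun α τ => deriv (fun a => G a τ) α

/-- Partial derivative in the second variable. -/
def pd₂ (G : ℝ → ℝ → ℝ) : ℝ → ℝ → ℝ := fun α τ => deriv (fun s => G α s) τ

/-- The signed curvature, at the point `(α, τ)`, of the level curve of `G` through that point: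
`(G_αα G_τ² - 2 G_ατ G_α G_τ + G_ττ G_α²) / (G_α² + G_τ²)^(3/2)`. -/
def implicitCurvature (G : ℝ → ℝ → ℝ) (α τ : ℝ) : ℝ :=
  (pd₁ (pd₁ G) α τ * pd₂ G α τ ^ 2
      - 2 * pd₂ (pd₁ G) α τ * pd₁ G α τ * pd₂ G α τ
      + pd₂ (pd₂ G) α τ * pd₁ G α τ ^ 2)
    / (pd₁ G α τ ^ 2 + pd₂ G α τ ^ 2) ^ (3 / 2 : ℝ)

/-- The curvature function `κ(α, τ)` of the level curves of the distance from `w = Φ(u, v)`.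
The constant `2 (1 - t)` in `levelFun u v t` does not affect partial derivatives, so `κ` does not
depend on `t` and is computed from the squared distance. -/
def kappa (u v α τ : ℝ) : ℝ := implicitCurvature (sqDist u v) α τ

/-- The open cylinder `(ℝ/ℤ) × (0, 1)`, represented by the fundamental domain `[0, 1) × (0, 1)`.
(The sides `τ = 0` and `τ = 1` are collapsed to the poles by the Lambert map, and `κ` is not
defined there.) -/
def openCylinder : Set (ℝ × ℝ) := Set.Ico (0 : ℝ) 1 ×ˢ Set.Ioo (0 : ℝ) 1

/-- The level curve with parameter `t` of the distance function from `Φ(u, v)`. -/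
def levelCurve (u v t : ℝ) : Set (ℝ × ℝ) :=
  {P | P ∈ openCylinder ∧ levelFun u v t P.1 P.2 = 0}

/-- The curve of zeros of the curvature function: the points where `κ` is defined (that is, its
denominator does not vanish) and equal to zero. -/
def zeroCurve (u v : ℝ) : Set (ℝ × ℝ) :=
  {P | P ∈ openCylinder ∧
    pd₁ (sqDist u v) P.1 P.2 ^ 2 + pd₂ (sqDist u v) P.1 P.2 ^ 2 ≠ 0 ∧
    kappa u v P.1 P.2 = 0}

/-- `P` and `Q` are two distinct points of the open cylinder that are mirror images of each other
with respect to the vertical line `α = u`, the first coordinate being taken modulo `1`. -/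
def IsSymmetricPair (u : ℝ) (P Q : ℝ × ℝ) : Prop :=
  P ∈ openCylinder ∧ Q ∈ openCylinder ∧ P ≠ Q ∧
    Q.1 = Int.fract (2 * u - P.1) ∧ Q.2 = P.2

/-- The implicit curves through `P` given by `f` and `g` are both regular at `P` and have the
same tangent line there. -/
def TangentAt (f g : ℝ × ℝ → ℝ) (P : ℝ × ℝ) : Prop :=
  ∃ f' g' : ℝ × ℝ →L[ℝ] ℝ, HasFDerivAt f f' P ∧ HasFDerivAt g g' P ∧ f' ≠ 0 ∧ g' ≠ 0 ∧
    ∀ d : ℝ × ℝ, f' d = 0 ↔ g' d = 0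

/-- The level curve with parameter `t` and the curve of zeros of `κ` are tangent at `P`. -/
def CurvesTangentAt (u v t : ℝ) (P : ℝ × ℝ) : Prop :=
  TangentAt (fun R => levelFun u v t R.1 R.2) (fun R => kappa u v R.1 R.2) P

end

open Set Topology

/-! Put h = 1 - 2v, z = 1 - 2τ, and let t be the inner product of w with Φ(α, τ). Since the squared
distance is 2 - 2t, the curvature is a nowhere zero factor times a polynomial in h, t, z alone:
`levelPoly`, of degree at most four in z (`kappa_eq`). A point of the level curve with sin(2π(α -
u)) = 0 never has zero curvature. The intersection therefore consists of one symmetric pair for each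
root z lying strictly between the extremal heights th ± s, where s² = (1 - t²)(1 - h²)
(`mem_levelCurve_inter_zeroCurve`, `exists_symmetricPair`).

It remains to count roots, and by the symmetry (t, z) ↦ (-t, -z) one may take t ≥ 0. The signs of
the quartic at -1, at th ± s, at 1 and far to the right are explicit. For 0 < t < h they alternate,
which gives four roots in disjoint intervals, exactly one of them in the band. For t > h two roots
are forced outside the band, which leaves at most two inside, with negative values at both ends. A
single root in the band is then a local maximum, so the z-derivative vanishes there
(`levelRoots_of_gt`).

At such a root the gradient of κ is a multiple of the t-derivative of the quartic times the gradient
of the inner product. Tangency thus amounts to this t-derivative being nonzero, that is, to the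
plane curve cut out by the quartic having no singular point with |z| < 1 (`levelPolyT_ne_zero`). -/

/-! ### The quartic and its symmetry -/

/-- The quartic in `z` whose zeros are the heights `z = 1 - 2 τ` of the points of the level curve
with parameter `t` at which the curvature vanishes; here `h = 1 - 2 v`. -/
def levelPoly (h t z : ℝ) : ℝ :=
  2 * t * z ^ 4 - 3 * h * (1 + t ^ 2) * z ^ 3 + (t ^ 3 - t + 6 * t * h ^ 2) * z ^ 2
    + (3 * h - 2 * h ^ 3 - 3 * t ^ 2 * h) * z + (t ^ 3 - t)

/-- The derivative of `levelPoly` with respect to `z`. -/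
def levelPolyZ (h t z : ℝ) : ℝ :=
  8 * t * z ^ 3 - 9 * h * (1 + t ^ 2) * z ^ 2 + 2 * (t ^ 3 - t + 6 * t * h ^ 2) * z
    + (3 * h - 2 * h ^ 3 - 3 * t ^ 2 * h)

/-- The derivative of `levelPoly` with respect to `t`. -/
def levelPolyT (h t z : ℝ) : ℝ :=
  2 * z ^ 4 - 6 * h * t * z ^ 3 + (3 * t ^ 2 - 1 + 6 * h ^ 2) * z ^ 2 - 6 * t * h * z
    + (3 * t ^ 2 - 1)

/-- The admissible heights: zeros of `levelPoly` strictly between the extremal heights of the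
level curve. -/
def levelRoots (h t : ℝ) : Set ℝ :=
  {z | (z - t * h) ^ 2 < (1 - t ^ 2) * (1 - h ^ 2) ∧ levelPoly h t z = 0}

lemma hasDerivAt_levelPoly (h t z : ℝ) :
    HasDerivAt (fun z => levelPoly h t z) (levelPolyZ h t z) z := by
  unfold levelPoly levelPolyZ
  have e := (((((hasDerivAt_id z).pow 4).const_mul (2 * t)).sub
    (((hasDerivAt_id z).pow 3).const_mul (3 * h * (1 + t ^ 2)))).add
    (((hasDerivAt_id z).pow 2).const_mul (t ^ 3 - t + 6 * t * h ^ 2))).add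
    ((hasDerivAt_id z).const_mul (3 * h - 2 * h ^ 3 - 3 * t ^ 2 * h)) |>.add_const (t ^ 3 - t)
  refine (e.congr_deriv ?_).congr_of_eventuallyEq (.of_forall fun x => ?_)
  · simp; ring
  · simp

lemma continuous_levelPoly (h t : ℝ) : Continuous fun z => levelPoly h t z := by
  unfold levelPoly; fun_prop

lemma exists_zero_of_neg_pos {f : ℝ → ℝ} (hf : Continuous f) {a b : ℝ} (hab : a < b)
    (ha : f a < 0) (hb : 0 < f b) : ∃ c ∈ Ioo a b, f c = 0 :=
  intermediate_value_Ioo hab.le hf.continuousOn ⟨ha, hb⟩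

lemma exists_zero_of_pos_neg {f : ℝ → ℝ} (hf : Continuous f) {a b : ℝ} (hab : a < b)
    (ha : 0 < f a) (hb : f b < 0) : ∃ c ∈ Ioo a b, f c = 0 :=
  intermediate_value_Ioo' hab.le hf.continuousOn ⟨hb, ha⟩

open Polynomial in
lemma levelPoly_card_zeros_le {h t : ℝ} (ht : t ≠ 0) (s : Finset ℝ)
    (hs : ∀ z ∈ s, levelPoly h t z = 0) : s.card ≤ 4 := by
  set p : ℝ[X] := C (2 * t) * X ^ 4 + C (-(3 * h * (1 + t ^ 2))) * X ^ 3
    + C (t ^ 3 - t + 6 * t * h ^ 2) * X ^ 2 + C (3 * h - 2 * h ^ 3 - 3 * t ^ 2 * h) * X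
    + C (t ^ 3 - t) with hp
  have hd : p.natDegree = 4 := by
    rw [hp]; compute_degree!
  by_contra! hc
  have h0 : p = 0 := Polynomial.eq_zero_of_natDegree_lt_card_of_eval_eq_zero' p s
    (fun z hz => by
      have := hs z hz
      simp only [hp, eval_add, eval_mul, eval_C, eval_pow, eval_X]
      unfold levelPoly at this; linarith) (by omega)
  rw [h0] at hd
  simp at hd

lemma levelPoly_neg (h t z : ℝ) : levelPoly h (-t) (-z) = -levelPoly h t z := by
  unfold levelPoly; ring

lemma levelPolyZ_neg (h t z : ℝ) : levelPolyZ h (-t) (-z) = levelPolyZ h t z := by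
  unfold levelPolyZ; ring

lemma neg_mem_levelRoots {h t z : ℝ} : -z ∈ levelRoots h (-t) ↔ z ∈ levelRoots h t := by
  unfold levelRoots
  simp only [mem_ofPred_eq, levelPoly_neg, neg_eq_zero]
  rw [show (-z - -t * h) ^ 2 = (z - t * h) ^ 2 by ring, neg_sq]

lemma levelRoots_neg (h t : ℝ) : levelRoots h (-t) = (fun z => -z) '' levelRoots h t := by
  ext z
  constructor
  · intro hz
    exact ⟨-z, by rwa [← neg_mem_levelRoots, neg_neg], neg_neg z⟩
  · rintro ⟨y, hy, rfl⟩
    exact neg_mem_levelRoots.2 hy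

lemma levelPoly_one (h t : ℝ) : levelPoly h t 1 = 2 * (t - h) ^ 3 := by
  unfold levelPoly; ring

lemma levelPoly_neg_one (h t : ℝ) : levelPoly h t (-1) = 2 * (t + h) ^ 3 := by
  unfold levelPoly; ring

/-- The hypothesis is a vanishing Gram determinant, symmetric in t, h, z. Solved for (t - hz)², it
reduces the quartic to a product whose sign is that of hz - t wherever h ≠ zt. -/
lemma levelPoly_extremal {h t z : ℝ} (hz : (z - t * h) ^ 2 = (1 - t ^ 2) * (1 - h ^ 2)) :
    levelPoly h t z = -(t - h * z) * (h - z * t) ^ 2 := by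
  have e : (t - h * z) ^ 2 = (1 - h ^ 2) * (1 - z ^ 2) := by linarith
  unfold levelPoly
  linear_combination (-(2 * h * z * (1 - z ^ 2)) + (t - h * z) * (1 + 2 * z ^ 2)) * e

/-! ### Signs of the quartic at the ends of the band and beyond -/

section signs

variable {h t s : ℝ}

lemma levelPoly_lower_neg (h0 : 0 < h) (h1 : h < 1) (t0 : 0 ≤ t) (t1 : t < 1) (s0 : 0 < s)
    (hs : s ^ 2 = (1 - t ^ 2) * (1 - h ^ 2)) : levelPoly h t (t * h - s) < 0 := by
  rw [levelPoly_extremal (by linarith)]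
  have a : 0 < t - h * (t * h - s) := by
    nlinarith [mul_nonneg t0 (show (0:ℝ) ≤ 1 - h ^ 2 by nlinarith), mul_pos h0 s0]
  have b : 0 < h - (t * h - s) * t := by
    nlinarith [mul_pos h0 (show (0:ℝ) < 1 - t ^ 2 by nlinarith), mul_nonneg t0 s0.le]
  nlinarith [mul_pos a (pow_pos b 2)]

lemma levelPoly_upper_pos (h0 : 0 < h) (h1 : h < 1) (t0 : 0 ≤ t) (th : t < h) (s0 : 0 < s)
    (hs : s ^ 2 = (1 - t ^ 2) * (1 - h ^ 2)) : 0 < levelPoly h t (t * h + s) := by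
  rw [levelPoly_extremal (by linarith)]
  have hh : 0 < 1 - h ^ 2 := by nlinarith
  have tt : 0 < 1 - t ^ 2 := by nlinarith
  -- After squaring and inserting s², this and the next inequality both become t² < h².
  have a : t * (1 - h ^ 2) < h * s := by
    refine lt_of_pow_lt_pow_left₀ 2 (by positivity) ?_
    have : t ^ 2 < h ^ 2 := by nlinarith
    rw [mul_pow, mul_pow, hs]
    nlinarith [mul_pos hh (sub_pos.2 this)]
  have b : t * s < h * (1 - t ^ 2) := by
    refine lt_of_pow_lt_pow_left₀ 2 (by positivity) ?_
    have : t ^ 2 < h ^ 2 := by nlinarith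
    rw [mul_pow, mul_pow, hs]
    nlinarith [mul_pos tt (sub_pos.2 this)]
  have b' : 0 < h - (t * h + s) * t := by linarith
  nlinarith [mul_pos (show 0 < -(t - h * (t * h + s)) by linarith) (pow_pos b' 2)]

lemma levelPoly_upper_neg (h0 : 0 < h) (h1 : h < 1) (th : h < t) (t1 : t < 1) (s0 : 0 < s)
    (hs : s ^ 2 = (1 - t ^ 2) * (1 - h ^ 2)) : levelPoly h t (t * h + s) < 0 := by
  rw [levelPoly_extremal (by linarith)]
  have t0 : 0 < t := h0.trans th
  have hh : 0 < 1 - h ^ 2 := by nlinarith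
  have tt : 0 < 1 - t ^ 2 := by nlinarith
  have a : h * s < t * (1 - h ^ 2) := by
    refine lt_of_pow_lt_pow_left₀ 2 (by positivity) ?_
    have : h ^ 2 < t ^ 2 := by nlinarith
    rw [mul_pow, mul_pow, hs]
    nlinarith [mul_pos hh (sub_pos.2 this)]
  have b : h * (1 - t ^ 2) < t * s := by
    refine lt_of_pow_lt_pow_left₀ 2 (by positivity) ?_
    have : h ^ 2 < t ^ 2 := by nlinarith
    rw [mul_pow, mul_pow, hs]
    nlinarith [mul_pos tt (sub_pos.2 this)]
  have b' : 0 < -(h - (t * h + s) * t) := by linarith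
  nlinarith [mul_pos (show 0 < t - h * (t * h + s) by linarith) (pow_pos b' 2)]

lemma upper_lt_one (h0 : 0 < h) (h1 : h < 1) (t1 : t < 1) (th : t ≠ h)
    (hs : s ^ 2 = (1 - t ^ 2) * (1 - h ^ 2)) : t * h + s < 1 := by
  have : s < 1 - t * h := by
    refine lt_of_pow_lt_pow_left₀ 2 (by nlinarith) ?_
    -- (1 - th)² - s² = (t - h)².
    nlinarith [pow_pos (abs_pos.2 (sub_ne_zero.2 th)) 2, sq_abs (t - h)]
  linarith

lemma neg_one_lt_lower (h0 : 0 < h) (t0 : 0 ≤ t)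
    (hs : s ^ 2 = (1 - t ^ 2) * (1 - h ^ 2)) : -1 < t * h - s := by
  have : s < 1 + t * h := by
    refine lt_of_pow_lt_pow_left₀ 2 (by nlinarith) ?_
    nlinarith [pow_pos (add_pos_of_nonneg_of_pos t0 h0) 2]
  linarith

/-- At B = 10 / t the quartic term is 20 B³, while the cubic term is at least -6 B³; since B > 10,
the surplus absorbs the lower terms. -/
lemma levelPoly_pos_of_large (h0 : 0 < h) (h1 : h < 1) (t0 : 0 < t) (t1 : t < 1) :
    0 < levelPoly h t (10 / t) := by
  set B := 10 / t with hB
  have tB : t * B = 10 := by rw [hB]; field_simp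
  have B1 : 10 < B := by rw [hB, lt_div_iff₀ t0]; linarith
  have e : levelPoly h t B = 20 * B ^ 3 - 3 * h * (1 + t ^ 2) * B ^ 3
      + (t ^ 3 - t + 6 * t * h ^ 2) * B ^ 2
      + (3 * h - 2 * h ^ 3 - 3 * t ^ 2 * h) * B + (t ^ 3 - t) := by
    unfold levelPoly; linear_combination 2 * B ^ 3 * tB
  rw [e]
  have t2 : t ^ 2 ≤ 1 := by nlinarith
  have h2 : h ^ 2 ≤ 1 := by nlinarith
  have ht2 : h * t ^ 2 ≤ 1 := by nlinarith [sq_nonneg t]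
  have h3 : h ^ 3 ≤ h := by nlinarith
  have t3 : 0 < t ^ 3 := by positivity
  have c3 : 3 * h * (1 + t ^ 2) ≤ 6 := by nlinarith
  have c2 : -1 ≤ t ^ 3 - t + 6 * t * h ^ 2 := by nlinarith [mul_nonneg t0.le (sq_nonneg h)]
  have c1 : -3 ≤ 3 * h - 2 * h ^ 3 - 3 * t ^ 2 * h := by nlinarith
  have b2 : 0 < B ^ 2 := by positivity
  have b3 : 10 * B ^ 2 < B ^ 3 := by nlinarith
  have bb : 10 * B < B ^ 2 := by nlinarith
  nlinarith [mul_le_mul_of_nonneg_right c3 (by positivity : 0 ≤ B ^ 3),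
    mul_le_mul_of_nonneg_right c2 b2.le, mul_le_mul_of_nonneg_right c1 (by linarith : 0 ≤ B)]

lemma mem_levelRoots_iff (s0 : 0 < s) (hs : s ^ 2 = (1 - t ^ 2) * (1 - h ^ 2)) {z : ℝ} :
    z ∈ levelRoots h t ↔ z ∈ Ioo (t * h - s) (t * h + s) ∧ levelPoly h t z = 0 := by
  unfold levelRoots
  rw [mem_ofPred_eq, ← hs, sq_lt_sq, abs_of_pos s0, abs_lt, mem_Ioo]
  constructor <;> rintro ⟨⟨a, b⟩, c⟩ <;> exact ⟨⟨by linarith, by linarith⟩, c⟩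

lemma exists_extremal_width (h0 : 0 < h) (h1 : h < 1) (t0 : -1 < t) (t1 : t < 1) :
    ∃ s : ℝ, 0 < s ∧ s ^ 2 = (1 - t ^ 2) * (1 - h ^ 2) := by
  have : 0 < (1 - t ^ 2) * (1 - h ^ 2) := mul_pos (by nlinarith) (by nlinarith)
  exact ⟨_, Real.sqrt_pos.2 this, Real.sq_sqrt this.le⟩

end signs

/-! ### Counting the roots in the band -/

lemma five_zeros_false {h t a b c d e : ℝ} (ht : t ≠ 0) (ab : a < b) (bc : b < c) (cd : c < d)
    (de : d < e) (ha : levelPoly h t a = 0) (hb : levelPoly h t b = 0)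
    (hc : levelPoly h t c = 0) (hd : levelPoly h t d = 0) (he : levelPoly h t e = 0) : False := by
  have := levelPoly_card_zeros_le ht {a, b, c, d, e} (by
    intro z hz; simp only [Finset.mem_insert, Finset.mem_singleton] at hz
    rcases hz with rfl | rfl | rfl | rfl | rfl <;> assumption)
  have hcard : ({a, b, c, d, e} : Finset ℝ).card = 5 := by
    have h1 : a ∉ ({b, c, d, e} : Finset ℝ) := by
      simp only [Finset.mem_insert, Finset.mem_singleton]; rintro (r | r | r | r) <;> linarith
    have h2 : b ∉ ({c, d, e} : Finset ℝ) := by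
      simp only [Finset.mem_insert, Finset.mem_singleton]; rintro (r | r | r) <;> linarith
    have h3 : c ∉ ({d, e} : Finset ℝ) := by
      simp only [Finset.mem_insert, Finset.mem_singleton]; rintro (r | r) <;> linarith
    rw [Finset.card_insert_of_notMem h1, Finset.card_insert_of_notMem h2,
      Finset.card_insert_of_notMem h3, Finset.card_pair de.ne]
  omega

/-- The quartic degenerates to a cubic at t = 0, and its cofactor of z is positive on the band z² <
1 - h². -/
lemma levelRoots_zero {h : ℝ} (h0 : 0 < h) (h1 : h < 1) : levelRoots h 0 = {0} := by
  ext z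
  simp only [levelRoots, levelPoly, mem_ofPred_eq, mem_singleton_iff]
  constructor
  · rintro ⟨a, b⟩
    have e : z * (h * (3 - 2 * h ^ 2 - 3 * z ^ 2)) = 0 := by linarith
    refine (mul_eq_zero.1 e).resolve_right (mul_pos h0 ?_).ne'
    nlinarith
  · rintro rfl
    refine ⟨?_, by ring⟩
    nlinarith

/-- At t = h the upper end of the band is 1, a double root of the quartic. The remaining quadratic
changes sign across the band. -/
lemma levelRoots_self {h : ℝ} (h0 : 0 < h) (h1 : h < 1) : ∃ z, levelRoots h h = {z} := by
  have hh : 0 < 1 - h ^ 2 := by nlinarith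
  have fac : ∀ z, levelPoly h h z
      = (z - 1) ^ 2 * (h * (2 * z ^ 2 + (1 - 3 * h ^ 2) * z + h ^ 2 - 1)) := by
    intro z; unfold levelPoly; ring
  have mem : ∀ z, z ∈ levelRoots h h ↔ z ∈ Ioo (2 * h ^ 2 - 1) 1 ∧
      2 * z ^ 2 + (1 - 3 * h ^ 2) * z + h ^ 2 - 1 = 0 := by
    intro z
    rw [mem_levelRoots_iff hh (by ring), fac]
    rw [show h * h - (1 - h ^ 2) = 2 * h ^ 2 - 1 by ring, show h * h + (1 - h ^ 2) = 1 by ring]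
    refine and_congr_right fun hz => ?_
    have : (z - 1) ^ 2 ≠ 0 := pow_ne_zero _ (by linarith [hz.2])
    simp [this, h0.ne']
  have lo : 2 * (2 * h ^ 2 - 1) ^ 2 + (1 - 3 * h ^ 2) * (2 * h ^ 2 - 1) + h ^ 2 - 1 < 0 := by
    nlinarith [mul_pos (pow_pos h0 2) hh]
  obtain ⟨z, hz, hz0⟩ := exists_zero_of_neg_pos
    (f := fun z => 2 * z ^ 2 + (1 - 3 * h ^ 2) * z + h ^ 2 - 1) (by fun_prop)
    (show 2 * h ^ 2 - 1 < 1 by linarith) lo (by nlinarith)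
  have uniq : ∀ x y, 2 * h ^ 2 - 1 < x → x < y →
      2 * x ^ 2 + (1 - 3 * h ^ 2) * x + h ^ 2 - 1 = 0 →
      2 * y ^ 2 + (1 - 3 * h ^ 2) * y + h ^ 2 - 1 = 0 → False := by
    intro x y hx hxy ex ey
    have e : (y - x) * (2 * (x + y) + (1 - 3 * h ^ 2)) = 0 := by linarith
    have e' := (mul_eq_zero.1 e).resolve_left (by linarith)
    -- With two roots x, y the quadratic is 2(z - x)(z - y), which is positive to the left of both
    -- and so contradicts `lo`.
    have e2 : 2 * (2 * h ^ 2 - 1) ^ 2 + (1 - 3 * h ^ 2) * (2 * h ^ 2 - 1) + h ^ 2 - 1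
      = 2 * (x - (2 * h ^ 2 - 1)) * (y - (2 * h ^ 2 - 1)) := by
      linear_combination ex + (2 * h ^ 2 - 1 - x) * e'
    nlinarith [mul_pos (sub_pos.2 hx) (sub_pos.2 (hx.trans hxy))]
  refine ⟨z, ?_⟩
  ext y
  rw [mem, mem_singleton_iff]
  constructor
  · rintro ⟨hy, hy0⟩
    rcases lt_trichotomy y z with H | H | H
    · exact (uniq y z hy.1 H hy0 hz0).elim
    · exact H
    · exact (uniq z y hz.1 H hz0 hy0).elim
  · rintro rfl
    exact ⟨hz, hz0⟩

lemma levelRoots_of_lt {h t : ℝ} (h1 : h < 1) (t0 : 0 < t) (th : t < h) :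
    ∃ z, levelRoots h t = {z} := by
  have h0 : 0 < h := t0.trans th
  have t1 : t < 1 := th.trans h1
  obtain ⟨s, s0, hs⟩ := exists_extremal_width h0 h1 (by linarith : -1 < t) t1
  have hc := continuous_levelPoly h t
  have lo := levelPoly_lower_neg h0 h1 t0.le t1 s0 hs
  have up := levelPoly_upper_pos h0 h1 t0.le th s0 hs
  obtain ⟨z, hz, hz0⟩ := exists_zero_of_neg_pos hc (by linarith : t * h - s < t * h + s) lo up
  obtain ⟨a, ha, ha0⟩ := exists_zero_of_pos_neg hc (neg_one_lt_lower h0 t0.le hs)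
    (by rw [levelPoly_neg_one]; positivity) lo
  obtain ⟨b, hb, hb0⟩ := exists_zero_of_pos_neg hc (upper_lt_one h0 h1 t1 th.ne hs) up
    (by rw [levelPoly_one]; nlinarith [pow_pos (sub_pos.2 th) 3])
  obtain ⟨c, hc, hc0⟩ := exists_zero_of_neg_pos hc
    (show 1 < 10 / t by rw [lt_div_iff₀ t0]; linarith)
    (by rw [levelPoly_one]; nlinarith [pow_pos (sub_pos.2 th) 3])
    (levelPoly_pos_of_large h0 h1 t0 t1)
  refine ⟨z, ?_⟩
  ext y
  rw [mem_levelRoots_iff s0 hs, mem_singleton_iff]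
  constructor
  · rintro ⟨hy, hy0⟩
    rcases lt_trichotomy y z with H | H | H
    · exact (five_zeros_false t0.ne' (ha.2.trans hy.1) H (hz.2.trans hb.1) (hb.2.trans hc.1)
        ha0 hy0 hz0 hb0 hc0).elim
    · exact H
    · exact (five_zeros_false t0.ne' (ha.2.trans hz.1) H (hy.2.trans hb.1) (hb.2.trans hc.1)
        ha0 hz0 hy0 hb0 hc0).elim
  · rintro rfl
    exact ⟨hz, hz0⟩

lemma levelRoots_eq_singleton {h t : ℝ} (h0 : 0 < h) (h1 : h < 1) (t0 : -h ≤ t) (th : t ≤ h) :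
    ∃ z, levelRoots h t = {z} := by
  have key : ∀ t, 0 ≤ t → t ≤ h → ∃ z, levelRoots h t = {z} := by
    intro t t0 th
    rcases t0.eq_or_lt with rfl | t0
    · exact ⟨0, levelRoots_zero h0 h1⟩
    rcases th.eq_or_lt with rfl | th
    · exact levelRoots_self h0 h1
    · exact levelRoots_of_lt h1 t0 th
  rcases le_total 0 t with H | H
  · exact key t H th
  · obtain ⟨z, hz⟩ := key (-t) (by linarith) (by linarith)
    refine ⟨-z, ?_⟩
    rw [← neg_neg t, levelRoots_neg, hz, image_singleton]

lemma levelRoots_of_gt {h t : ℝ} (h0 : 0 < h) (th : h < t) (t1 : t < 1) :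
    levelRoots h t = ∅ ∨ (∃ z, levelRoots h t = {z} ∧ levelPolyZ h t z = 0) ∨
      ∃ z z', z ≠ z' ∧ levelRoots h t = {z, z'} := by
  have h1 : h < 1 := th.trans t1
  have t0 : 0 < t := h0.trans th
  obtain ⟨s, s0, hs⟩ := exists_extremal_width h0 h1 (by linarith : -1 < t) t1
  have hc := continuous_levelPoly h t
  have lo := levelPoly_lower_neg h0 h1 t0.le t1 s0 hs
  have up := levelPoly_upper_neg h0 h1 th t1 s0 hs
  obtain ⟨a, ha, ha0⟩ := exists_zero_of_pos_neg hc (neg_one_lt_lower h0 t0.le hs)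
    (by rw [levelPoly_neg_one]; positivity) lo
  obtain ⟨b, hb, hb0⟩ := exists_zero_of_neg_pos hc (upper_lt_one h0 h1 t1 th.ne' hs) up
    (by rw [levelPoly_one]; have := pow_pos (sub_pos.2 th) 3; linarith)
  have mem := fun z => mem_levelRoots_iff (h := h) (t := t) s0 hs (z := z)
  have three : ∀ x y z, x ∈ levelRoots h t → y ∈ levelRoots h t → z ∈ levelRoots h t →
      x < y → y < z → False := by
    intro x y z hx hy hz xy yz
    rw [mem] at hx hy hz
    exact five_zeros_false t0.ne' (ha.2.trans hx.1.1) xy yz (hz.1.2.trans hb.1)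
      ha0 hx.2 hy.2 hz.2 hb0
  rcases (levelRoots h t).eq_empty_or_nonempty with H | ⟨z, hz⟩
  · exact .inl H
  by_cases H : levelRoots h t = {z}
  · refine .inr (.inl ⟨z, H, ?_⟩)
    have hz' := (mem z).1 hz
    have only : ∀ y, y ∈ Ioo (t * h - s) (t * h + s) → levelPoly h t y = 0 → y = z := by
      intro y hy hy0
      have : y ∈ levelRoots h t := (mem y).2 ⟨hy, hy0⟩
      rwa [H] at this
    -- A positive value inside the band, together with the negative value at the end on its side,
    -- would produce a second root there.
    have hmax : IsLocalMax (fun z => levelPoly h t z) z := by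
      filter_upwards [Ioo_mem_nhds hz'.1.1 hz'.1.2] with y hy
      simp only [hz'.2]
      by_contra! hpos
      rcases lt_trichotomy y z with hyz | hyz | hyz
      · obtain ⟨x, hx, hx0⟩ := exists_zero_of_neg_pos hc hy.1 lo hpos
        exact absurd (only x ⟨hx.1, hx.2.trans hy.2⟩ hx0) (by linarith [hx.2])
      · rw [hyz, hz'.2] at hpos; exact lt_irrefl _ hpos
      · obtain ⟨x, hx, hx0⟩ := exists_zero_of_pos_neg hc hy.2 hpos up
        exact absurd (only x ⟨hy.1.trans hx.1, hx.2⟩ hx0) (by linarith [hx.1])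
    exact hmax.hasDerivAt_eq_zero (hasDerivAt_levelPoly h t z)
  · refine .inr (.inr ?_)
    obtain ⟨z', hz', hne⟩ : ∃ z' ∈ levelRoots h t, z' ≠ z := by
      by_contra! hcon
      exact H (eq_singleton_iff_unique_mem.2 ⟨hz, hcon⟩)
    refine ⟨z, z', hne.symm, ?_⟩
    ext y
    simp only [mem_insert_iff, mem_singleton_iff]
    constructor
    · intro hy
      by_contra! hcon
      rcases lt_or_gt_of_ne hcon.1 with A | A <;> rcases lt_or_gt_of_ne hcon.2 with B | B <;>
        rcases lt_or_gt_of_ne hne with C | C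
      all_goals first
        | exact three _ _ _ hy hz hz' A C
        | exact three _ _ _ hy hz' hz B C
        | exact three _ _ _ hz hy hz' A B
        | exact three _ _ _ hz' hy hz B A
        | exact three _ _ _ hz hz' hy C B
        | exact three _ _ _ hz' hz hy C A
    · rintro (rfl | rfl) <;> assumption

lemma levelRoots_trichotomy {h t : ℝ} (h0 : 0 < h)
    (ht : (-1 < t ∧ t < -h) ∨ (h < t ∧ t < 1)) :
    levelRoots h t = ∅ ∨ (∃ z, levelRoots h t = {z} ∧ levelPolyZ h t z = 0) ∨
      ∃ z z', z ≠ z' ∧ levelRoots h t = {z, z'} := by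
  rcases ht with ⟨t1, th⟩ | ⟨th, t1⟩
  · rw [← neg_neg t, levelRoots_neg]
    rcases levelRoots_of_gt h0 (by linarith : h < -t) (by linarith) with
      H | ⟨z, H, hz⟩ | ⟨z, z', hne, H⟩
    · exact .inl (by rw [H, image_empty])
    · exact .inr (.inl ⟨-z, by rw [H, image_singleton], by rw [levelPolyZ_neg, hz]⟩)
    · exact .inr (.inr ⟨-z, -z', by simpa using hne, by rw [H, image_pair]⟩)
  · exact levelRoots_of_gt h0 th t1

/-! ### Nonsingularity of the curve of roots -/

/-- The zero set of `levelPoly`, as a plane curve in `(t, z)`, has no singular point. -/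
lemma levelPolyT_ne_zero {h t z : ℝ} (h0 : 0 < h) (h1 : h < 1) (hz : z ^ 2 < 1)
    (hP : levelPoly h t z = 0) (hZ : levelPolyZ h t z = 0) : levelPolyT h t z ≠ 0 := by
  intro hT
  -- In m = t - hz the quartic becomes a cubic without m² term. `E1` and `E2` say that m is a double
  -- root of it, and `E3` is the z-derivative at fixed m.
  obtain ⟨m, hm⟩ : ∃ m, m = t - h * z := ⟨_, rfl⟩
  obtain rfl : t = m + h * z := by linarith
  clear hm
  have E1 : 3 * (1 + z ^ 2) * m ^ 2 = (1 - z ^ 2) * (1 + 2 * z ^ 2 - 3 * z ^ 2 * h ^ 2) := by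
    unfold levelPolyT at hT; linear_combination hT
  have E2 : h * (1 - h ^ 2) * z * (1 - z ^ 2) ^ 2 = (1 + z ^ 2) * m ^ 3 := by
    unfold levelPoly at hP; linear_combination hP / 2 - m / 2 * E1
  have E3 : 4 * m * h ^ 2 * z * (1 - z ^ 2) + 2 * h * (1 - h ^ 2) * (1 - z ^ 2) * (1 - 5 * z ^ 2)
      - (1 - h ^ 2) * m * (4 * z * (1 - z ^ 2) - 2 * z * (1 + 2 * z ^ 2)) + 2 * z * m ^ 3 = 0 := by
    unfold levelPolyZ at hZ; unfold levelPolyT at hT; linear_combination hZ + h * hT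
  have hq : 0 < 1 - z ^ 2 := by linarith
  have hr : 0 < 1 - h ^ 2 := by nlinarith
  have m0 : m ≠ 0 := by
    rintro rfl
    have : 0 < 1 + 2 * z ^ 2 - 3 * z ^ 2 * h ^ 2 := by
      nlinarith [mul_nonneg (sq_nonneg z) hr.le]
    nlinarith [mul_pos hq this]
  generalize hx : z ^ 2 = x at *
  have x0 : 0 ≤ x := hx ▸ sq_nonneg z
  -- `E2` removes the terms of `E3` that are not multiples of m; after dividing by 2m only x = z²,
  -- h² and m² remain.
  have E3' : 2 * h ^ 2 * x * (1 - x) ^ 2 - (1 - h ^ 2) * x * (1 - x) * (1 - 4 * x)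
      + m ^ 2 * (1 - 3 * x - 6 * x ^ 2) = 0 := by
    have : (2 * m) * (2 * h ^ 2 * x * (1 - x) ^ 2 - (1 - h ^ 2) * x * (1 - x) * (1 - 4 * x)
      + m ^ 2 * (1 - 3 * x - 6 * x ^ 2)) = 0 := by
      have : z * z = x := by rw [← hx]; ring
      linear_combination z * (1 - x) * E3 - 2 * (1 - 5 * x) * E2
        - (4 * m * h ^ 2 * (1 - x) ^ 2 - (1 - x) * (1 - h ^ 2) * m * (4 * (1 - x)
          - 2 * (1 + 2 * x)) + 2 * (1 - x) * m ^ 3) * this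
    exact (mul_eq_zero.1 this).resolve_left (by simpa using m0)
  -- Eliminates m² between `E1` and `E3'`; `E5` then recovers m², and the square of `E2` gives `E6`.
  have E4 : 6 * x * h ^ 2 = 3 * x ^ 2 + 4 * x - 1 := by
    have : (1 - x) * (6 * x * h ^ 2 - (3 * x ^ 2 + 4 * x - 1)) = 0 := by
      linear_combination 3 * (1 + x) * E3' - (1 - 3 * x - 6 * x ^ 2) * E1
    linarith [(mul_eq_zero.1 this).resolve_left hq.ne']
  have xp : 0 < x := by
    refine x0.lt_of_ne ?_
    rintro rfl
    norm_num at E4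
  have E5 : m ^ 2 = (1 - x) ^ 2 / 2 := by
    have : (1 + x) * (m ^ 2 - (1 - x) ^ 2 / 2) = 0 := by
      linear_combination E1 / 3 - (1 - x) / 6 * E4
    linarith [(mul_eq_zero.1 this).resolve_left (by positivity)]
  have E6 : 8 * h ^ 2 * (1 - h ^ 2) ^ 2 * x = (1 + x) ^ 2 * (1 - x) ^ 2 := by
    have e : h ^ 2 * (1 - h ^ 2) ^ 2 * x * (1 - x) ^ 4 = (1 + x) ^ 2 * (m ^ 2) ^ 3 := by
      rw [← hx] at E2 ⊢
      linear_combination (h * (1 - h ^ 2) * z * (1 - z ^ 2) ^ 2 + (1 + z ^ 2) * m ^ 3) * E2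
    rw [E5] at e
    have : (1 - x) ^ 4 * (8 * h ^ 2 * (1 - h ^ 2) ^ 2 * x - (1 + x) ^ 2 * (1 - x) ^ 2) = 0 := by
      linear_combination 8 * e
    linarith [(mul_eq_zero.1 this).resolve_left (by positivity)]
  -- Eliminating h² from `E6` by `E4` leaves a polynomial in x whose quadratic factor is positive
  -- for x > 0.
  have E7 : (1 - x) ^ 2 * (9 * x ^ 2 + 2 * x + 1) = 0 := by
    have e : (6 * x * h ^ 2) * (6 * x - 6 * x * h ^ 2) ^ 2
        = 27 * x ^ 2 * ((1 + x) ^ 2 * (1 - x) ^ 2) := by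
      rw [← E6]; ring
    rw [E4] at e
    linear_combination -e
  have : 0 < (1 - x) ^ 2 * (9 * x ^ 2 + 2 * x + 1) := by positivity
  linarith


/-! ### The inner product and the partial derivatives of the squared distance -/

/-- The radius of the parallel of height `1 - 2 τ` on the unit sphere. -/
noncomputable def parallelRadius (τ : ℝ) : ℝ := 2 * Real.sqrt (τ - τ ^ 2)

/-- The inner product of `Φ(u, v)` and `Φ(α, τ)`. -/
noncomputable def lambertInner (u v α τ : ℝ) : ℝ :=
  parallelRadius v * parallelRadius τ * Real.cos (2 * Real.pi * (α - u))
    + (1 - 2 * v) * (1 - 2 * τ)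

lemma parallelRadius_sq {τ : ℝ} (hτ : τ ∈ Icc (0 : ℝ) 1) :
    parallelRadius τ ^ 2 = 1 - (1 - 2 * τ) ^ 2 := by
  unfold parallelRadius
  rw [mul_pow, Real.sq_sqrt (by nlinarith [hτ.1, hτ.2])]
  ring

lemma parallelRadius_pos {τ : ℝ} (hτ : τ ∈ Ioo (0 : ℝ) 1) : 0 < parallelRadius τ := by
  have : 0 < τ - τ ^ 2 := by nlinarith [hτ.1, hτ.2]
  unfold parallelRadius
  positivity

lemma hasDerivAt_parallelRadius {τ : ℝ} (hτ : τ ∈ Ioo (0 : ℝ) 1) :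
    HasDerivAt parallelRadius (2 * (1 - 2 * τ) / parallelRadius τ) τ := by
  have hp : 0 < τ - τ ^ 2 := by nlinarith [hτ.1, hτ.2]
  have e := (((hasDerivAt_id τ).sub ((hasDerivAt_id τ).pow 2)).sqrt
    (by simpa using hp.ne')).const_mul 2
  refine (e.congr_deriv ?_).congr_of_eventuallyEq (.of_forall fun x => ?_)
  · have := (Real.sqrt_pos.2 hp).ne'
    simp [parallelRadius]
    field_simp
  · simp [parallelRadius]

lemma sqDist_eq {u v α τ : ℝ} (hv : v ∈ Icc (0 : ℝ) 1) (hτ : τ ∈ Icc (0 : ℝ) 1) :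
    sqDist u v α τ = 2 - 2 * lambertInner u v α τ := by
  have h1 := parallelRadius_sq hv
  have h2 := parallelRadius_sq hτ
  have e : sqDist u v α τ
      = (parallelRadius v * Real.cos (2 * Real.pi * u)
          - parallelRadius τ * Real.cos (2 * Real.pi * α)) ^ 2
        + (parallelRadius v * Real.sin (2 * Real.pi * u)
          - parallelRadius τ * Real.sin (2 * Real.pi * α)) ^ 2
        + ((1 - 2 * v) - (1 - 2 * τ)) ^ 2 := by
    unfold sqDist
    rw [EuclideanSpace.norm_sq_eq, Fin.sum_univ_three]
    simp [lambert, parallelRadius]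
  rw [e, lambertInner, mul_sub, Real.cos_sub]
  linear_combination h1 + h2 + parallelRadius v ^ 2 * Real.sin_sq_add_cos_sq (2 * Real.pi * u)
    + parallelRadius τ ^ 2 * Real.sin_sq_add_cos_sq (2 * Real.pi * α)

section partials

variable {u v α τ : ℝ}

lemma hasDerivAt_angle (u α : ℝ) :
    HasDerivAt (fun a => 2 * Real.pi * (a - u)) (2 * Real.pi) α := by
  simpa using ((hasDerivAt_id α).sub_const u).const_mul (2 * Real.pi)

lemma pd₁_sqDist (hv : v ∈ Icc (0 : ℝ) 1) (hτ : τ ∈ Icc (0 : ℝ) 1) :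
    pd₁ (sqDist u v) α τ = 4 * Real.pi * parallelRadius v * parallelRadius τ
      * Real.sin (2 * Real.pi * (α - u)) := by
  unfold pd₁
  simp only [sqDist_eq hv hτ, lambertInner]
  have e := ((((hasDerivAt_angle u α).cos.const_mul (parallelRadius v * parallelRadius τ)).add_const
    ((1 - 2 * v) * (1 - 2 * τ))).const_mul 2).const_sub 2
  rw [e.deriv]
  ring

lemma hasDerivAt_sqDist_snd (hv : v ∈ Icc (0 : ℝ) 1) (hτ : τ ∈ Ioo (0 : ℝ) 1) :
    HasDerivAt (fun s => sqDist u v α s) (4 * ((1 - 2 * v) - parallelRadius v * (1 - 2 * τ)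
      * Real.cos (2 * Real.pi * (α - u)) / parallelRadius τ)) τ := by
  have e := (((((hasDerivAt_parallelRadius hτ).const_mul (parallelRadius v)).mul_const
    (Real.cos (2 * Real.pi * (α - u)))).add
    ((((hasDerivAt_id τ).const_mul 2).const_sub 1).const_mul (1 - 2 * v))).const_mul 2).const_sub 2
  refine (e.congr_deriv ?_).congr_of_eventuallyEq ?_
  · have := (parallelRadius_pos hτ).ne'
    field_simp
    ring
  · filter_upwards [Ioo_mem_nhds hτ.1 hτ.2] with s hs
    simp [sqDist_eq hv (Ioo_subset_Icc_self hs), lambertInner]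

lemma pd₂_sqDist (hv : v ∈ Icc (0 : ℝ) 1) (hτ : τ ∈ Ioo (0 : ℝ) 1) :
    pd₂ (sqDist u v) α τ = 4 * ((1 - 2 * v) - parallelRadius v * (1 - 2 * τ)
      * Real.cos (2 * Real.pi * (α - u)) / parallelRadius τ) :=
  (hasDerivAt_sqDist_snd hv hτ).deriv

lemma pd₁_pd₁_sqDist (hv : v ∈ Icc (0 : ℝ) 1) (hτ : τ ∈ Icc (0 : ℝ) 1) :
    pd₁ (pd₁ (sqDist u v)) α τ = 8 * Real.pi ^ 2 * parallelRadius v * parallelRadius τ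
      * Real.cos (2 * Real.pi * (α - u)) := by
  rw [pd₁]
  simp only [pd₁_sqDist hv hτ]
  rw [((hasDerivAt_angle u α).sin.const_mul _).deriv]
  ring

lemma pd₂_pd₁_sqDist (hv : v ∈ Icc (0 : ℝ) 1) (hτ : τ ∈ Ioo (0 : ℝ) 1) :
    pd₂ (pd₁ (sqDist u v)) α τ = 8 * Real.pi * parallelRadius v * (1 - 2 * τ)
      * Real.sin (2 * Real.pi * (α - u)) / parallelRadius τ := by
  have e := ((hasDerivAt_parallelRadius hτ).const_mul (4 * Real.pi * parallelRadius v)).mul_const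
    (Real.sin (2 * Real.pi * (α - u)))
  rw [pd₂, Filter.EventuallyEq.deriv_eq (f := fun s => 4 * Real.pi * parallelRadius v
    * parallelRadius s * Real.sin (2 * Real.pi * (α - u))), e.deriv]
  · ring
  · filter_upwards [Ioo_mem_nhds hτ.1 hτ.2] with s hs
    exact pd₁_sqDist hv (Ioo_subset_Icc_self hs)

lemma pd₂_pd₂_sqDist (hv : v ∈ Icc (0 : ℝ) 1) (hτ : τ ∈ Ioo (0 : ℝ) 1) :
    pd₂ (pd₂ (sqDist u v)) α τ = 8 * parallelRadius v * Real.cos (2 * Real.pi * (α - u))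
      / parallelRadius τ ^ 3 := by
  have hq := (parallelRadius_pos hτ).ne'
  have e := (((((((hasDerivAt_id τ).const_mul 2).const_sub 1).const_mul
    (parallelRadius v)).mul_const (Real.cos (2 * Real.pi * (α - u)))).div
    (hasDerivAt_parallelRadius hτ) hq).const_sub (1 - 2 * v)).const_mul 4
  rw [pd₂, Filter.EventuallyEq.deriv_eq (f := fun s => 4 * ((1 - 2 * v) - parallelRadius v
    * (1 - 2 * s) * Real.cos (2 * Real.pi * (α - u)) / parallelRadius s))]
  · refine (e.congr_deriv ?_).deriv
    have h2 := parallelRadius_sq (Ioo_subset_Icc_self hτ)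
    simp only [id]
    field_simp
    linear_combination (8 * parallelRadius v * Real.cos (2 * Real.pi * (α - u))) * h2
  · filter_upwards [Ioo_mem_nhds hτ.1 hτ.2] with s hs
    exact pd₂_sqDist hv hs

/-! ### The curvature in closed form -/

/-- The squared norm of the gradient of the squared distance, in closed form. -/
noncomputable def gradSq (u v α τ : ℝ) : ℝ :=
  (4 * Real.pi * parallelRadius v * parallelRadius τ * Real.sin (2 * Real.pi * (α - u))) ^ 2
    + (4 * ((1 - 2 * v) - parallelRadius v * (1 - 2 * τ)
      * Real.cos (2 * Real.pi * (α - u)) / parallelRadius τ)) ^ 2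

lemma gradSq_eq (hv : v ∈ Icc (0 : ℝ) 1) (hτ : τ ∈ Ioo (0 : ℝ) 1) :
    pd₁ (sqDist u v) α τ ^ 2 + pd₂ (sqDist u v) α τ ^ 2 = gradSq u v α τ := by
  rw [pd₁_sqDist hv (Ioo_subset_Icc_self hτ), pd₂_sqDist hv hτ, gradSq]

lemma levelPoly_lambertInner (hv : v ∈ Icc (0 : ℝ) 1) (hτ : τ ∈ Icc (0 : ℝ) 1) :
    levelPoly (1 - 2 * v) (lambertInner u v α τ) (1 - 2 * τ)
      = parallelRadius v * parallelRadius τ ^ 3 *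
        (-Real.cos (2 * Real.pi * (α - u)) * ((1 - 2 * v) * parallelRadius τ - parallelRadius v
            * (1 - 2 * τ) * Real.cos (2 * Real.pi * (α - u))) ^ 2
          + 2 * parallelRadius v * (1 - 2 * τ) * Real.sin (2 * Real.pi * (α - u)) ^ 2
            * ((1 - 2 * v) * parallelRadius τ - parallelRadius v
            * (1 - 2 * τ) * Real.cos (2 * Real.pi * (α - u)))
          - parallelRadius v ^ 2 * Real.cos (2 * Real.pi * (α - u))
            * Real.sin (2 * Real.pi * (α - u)) ^ 2) := by
  have h1 := parallelRadius_sq hv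
  have h2 := parallelRadius_sq hτ
  rw [Real.sin_sq]
  unfold lambertInner levelPoly
  generalize Real.cos (2 * Real.pi * (α - u)) = c
  generalize parallelRadius v = r at *
  generalize parallelRadius τ = q at *
  generalize 1 - 2 * v = h at *
  generalize 1 - 2 * τ = z at *
  -- Once r q c is named, r and q occur only through r² = 1 - h² and q² = 1 - z².
  obtain ⟨m, hm⟩ : ∃ m, m = r * q * c := ⟨_, rfl⟩
  have e : r * q ^ 3 * (-c * (h * q - r * z * c) ^ 2 + 2 * r * z * (1 - c ^ 2)
      * (h * q - r * z * c) - r ^ 2 * c * (1 - c ^ 2))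
      = -m * h ^ 2 * (q ^ 2) ^ 2 + 2 * h * r ^ 2 * z * (q ^ 2) ^ 2
        - r ^ 2 * (1 + 2 * z ^ 2) * m * q ^ 2 + (1 + z ^ 2) * m ^ 3 := by
    rw [hm]; ring
  rw [e, ← hm, h1, h2]
  ring

/-- Every term of the curvature numerator carries the same factor π², so π enters only through the
prefactor and the gradient. -/
lemma kappa_eq (hv : v ∈ Icc (0 : ℝ) 1) (hτ : τ ∈ Ioo (0 : ℝ) 1) :
    kappa u v α τ = -(128 * Real.pi ^ 2) / (parallelRadius τ ^ 4 * gradSq u v α τ ^ (3 / 2 : ℝ))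
      * levelPoly (1 - 2 * v) (lambertInner u v α τ) (1 - 2 * τ) := by
  have hq := (parallelRadius_pos hτ).ne'
  have hτ' := Ioo_subset_Icc_self hτ
  rw [kappa, implicitCurvature, gradSq_eq hv hτ, pd₁_pd₁_sqDist hv hτ', pd₂_pd₁_sqDist hv hτ,
    pd₂_pd₂_sqDist hv hτ, pd₁_sqDist hv hτ', pd₂_sqDist hv hτ, levelPoly_lambertInner hv hτ',
    div_mul_eq_mul_div, mul_comm (parallelRadius τ ^ 4), ← div_div, div_right_comm]
  field_simp
  ring

lemma kappa_eq_zero_iff (hv : v ∈ Icc (0 : ℝ) 1) (hτ : τ ∈ Ioo (0 : ℝ) 1)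
    (hg : gradSq u v α τ ≠ 0) : kappa u v α τ = 0 ↔
      levelPoly (1 - 2 * v) (lambertInner u v α τ) (1 - 2 * τ) = 0 := by
  have hq := (parallelRadius_pos hτ).ne'
  have hg' : 0 < gradSq u v α τ := lt_of_le_of_ne (by unfold gradSq; positivity) hg.symm
  have := Real.pi_pos
  rw [kappa_eq hv hτ, mul_eq_zero, or_iff_right]
  have := Real.rpow_pos_of_pos hg' (3 / 2)
  rw [neg_div, neg_eq_zero]
  positivity

/-- The gradient can vanish only at w and its antipode; hence it does not vanish on a level curve
with |t| < 1. -/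
lemma gradSq_eq_zero (hv : v ∈ Ioo (0 : ℝ) 1) (hτ : τ ∈ Ioo (0 : ℝ) 1)
    (hg : gradSq u v α τ = 0) : lambertInner u v α τ ^ 2 = 1 := by
  have hq := parallelRadius_pos hτ
  have hr := parallelRadius_pos hv
  have h1 := parallelRadius_sq (Ioo_subset_Icc_self hv)
  have h2 := parallelRadius_sq (Ioo_subset_Icc_self hτ)
  have hsc := Real.sin_sq_add_cos_sq (2 * Real.pi * (α - u))
  obtain ⟨hA, hB⟩ := (add_eq_zero_iff_of_nonneg (sq_nonneg _) (sq_nonneg _)).1 hg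
  have hs : Real.sin (2 * Real.pi * (α - u)) = 0 := by
    have := Real.pi_pos
    simpa [hq.ne', hr.ne', this.ne'] using hA
  have hB' : (1 - 2 * v) * parallelRadius τ = parallelRadius v * (1 - 2 * τ)
      * Real.cos (2 * Real.pi * (α - u)) := by
    have := pow_eq_zero_iff (two_ne_zero) |>.1 hB
    have e : (1 - 2 * v) - parallelRadius v * (1 - 2 * τ)
      * Real.cos (2 * Real.pi * (α - u)) / parallelRadius τ = 0 := by linarith
    field_simp at e
    linarith
  unfold lambertInner
  rw [hs] at hsc
  generalize Real.cos (2 * Real.pi * (α - u)) = c at *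
  generalize parallelRadius v = r at *
  generalize parallelRadius τ = q at *
  generalize 1 - 2 * v = h at *
  generalize 1 - 2 * τ = z at *
  have hc : c ^ 2 = 1 := by linarith
  -- For c² = 1, (rqc + hz)² + (hqc - rz)² = (r² + h²)(q² + z²) = 1.
  have e : h * q * c = r * z := by linear_combination c * hB' + r * z * hc
  linear_combination (-(h * q * c - r * z)) * e + q ^ 2 * (r ^ 2 + h ^ 2) * hc
    + (q ^ 2 + z ^ 2) * h1 + h2

/-- When the sine vanishes, the curvature numerator is a nonzero multiple of the square of the
τ-derivative, so its vanishing would kill the whole gradient. This is why the band is open. -/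
lemma sin_ne_zero_of_levelPoly_eq_zero (hv : v ∈ Ioo (0 : ℝ) 1) (hτ : τ ∈ Ioo (0 : ℝ) 1)
    (hg : gradSq u v α τ ≠ 0)
    (h0 : levelPoly (1 - 2 * v) (lambertInner u v α τ) (1 - 2 * τ) = 0) :
    Real.sin (2 * Real.pi * (α - u)) ≠ 0 := by
  intro hs
  apply hg
  have hq := parallelRadius_pos hτ
  have hr := parallelRadius_pos hv
  have hsc := Real.sin_sq_add_cos_sq (2 * Real.pi * (α - u))
  have hc : Real.cos (2 * Real.pi * (α - u)) ≠ 0 := by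
    intro hc; rw [hs, hc] at hsc; norm_num at hsc
  rw [levelPoly_lambertInner (Ioo_subset_Icc_self hv) (Ioo_subset_Icc_self hτ), hs] at h0
  have e : (1 - 2 * v) * parallelRadius τ - parallelRadius v
            * (1 - 2 * τ) * Real.cos (2 * Real.pi * (α - u)) = 0 := by
    simpa [hq.ne', hr.ne', hc] using h0
  have e' : (1 - 2 * v) - parallelRadius v * (1 - 2 * τ)
      * Real.cos (2 * Real.pi * (α - u)) / parallelRadius τ = 0 := by
    field_simp
    linarith
  rw [gradSq, hs, e']
  ring

end partials

/-! ### The intersection in terms of roots, and tangency -/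

/-- The intersection of the level curve and the zero curve, described through the admissible
heights. -/
lemma mem_levelCurve_inter_zeroCurve {u v t : ℝ} (hv : v ∈ Ioo (0 : ℝ) 1) (ht : t ^ 2 < 1)
    {P : ℝ × ℝ} : P ∈ levelCurve u v t ∩ zeroCurve u v ↔
      P.1 ∈ Ico (0 : ℝ) 1 ∧ P.2 ∈ Ioo (0 : ℝ) 1 ∧ 1 - 2 * P.2 ∈ levelRoots (1 - 2 * v) t ∧
        lambertInner u v P.1 P.2 = t := by
  obtain ⟨α, τ⟩ := P
  have hv' := Ioo_subset_Icc_self hv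
  simp only [levelCurve, zeroCurve, openCylinder, mem_inter_iff, mem_ofPred_eq, mem_prod]
  have lev : ∀ hτ : τ ∈ Ioo (0 : ℝ) 1, levelFun u v t α τ = 0 ↔ lambertInner u v α τ = t := by
    intro hτ
    rw [levelFun, sqDist_eq hv' (Ioo_subset_Icc_self hτ)]
    constructor <;> intro <;> linarith
  constructor
  · rintro ⟨⟨⟨hα, hτ⟩, hl⟩, -, hg, hk⟩
    rw [lev hτ] at hl
    rw [gradSq_eq hv' hτ] at hg
    rw [kappa_eq_zero_iff hv' hτ hg] at hk
    have hs := sin_ne_zero_of_levelPoly_eq_zero hv hτ hg hk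
    refine ⟨hα, hτ, ⟨?_, by rwa [hl] at hk⟩, hl⟩
    have h1 := parallelRadius_sq hv'
    have h2 := parallelRadius_sq (Ioo_subset_Icc_self hτ)
    have hsc := Real.sin_sq_add_cos_sq (2 * Real.pi * (α - u))
    have hp : 0 < (parallelRadius v * parallelRadius τ * Real.sin (2 * Real.pi * (α - u))) ^ 2 := by
      have := parallelRadius_pos hv
      have := parallelRadius_pos hτ
      positivity
    rw [← hl]
    unfold lambertInner
    generalize Real.cos (2 * Real.pi * (α - u)) = c at *
    generalize Real.sin (2 * Real.pi * (α - u)) = s at *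
    generalize parallelRadius v = r at *
    generalize parallelRadius τ = q at *
    generalize 1 - 2 * v = h at *
    generalize 1 - 2 * τ = z at *
    -- The gap in the band inequality is the square (r q s)², with s the sine.
    have : (1 - (r * q * c + h * z) ^ 2) * (1 - h ^ 2) - (z - (r * q * c + h * z) * h) ^ 2
        = (r * q * s) ^ 2 := by
      linear_combination (-(r ^ 2 * q ^ 2)) * hsc - q ^ 2 * h1 - (1 - h ^ 2) * h2
    linarith
  · rintro ⟨hα, hτ, ⟨-, hz⟩, hl⟩
    have hg : gradSq u v α τ ≠ 0 := by
      intro hg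
      have := gradSq_eq_zero hv hτ hg
      rw [hl] at this
      linarith
    exact ⟨⟨⟨hα, hτ⟩, (lev hτ).2 hl⟩, ⟨hα, hτ⟩, by rwa [gradSq_eq hv' hτ],
      by rwa [kappa_eq_zero_iff hv' hτ hg, hl]⟩

lemma hasFDerivAt_levelPoly (h : ℝ) (p : ℝ × ℝ) :
    HasFDerivAt (fun p : ℝ × ℝ => levelPoly h p.1 p.2)
      (levelPolyT h p.1 p.2 • ContinuousLinearMap.fst ℝ ℝ ℝ
        + levelPolyZ h p.1 p.2 • ContinuousLinearMap.snd ℝ ℝ ℝ) p := by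
  have dT : HasDerivAt (fun t => levelPoly h t p.2) (levelPolyT h p.1 p.2) p.1 := by
    have e := ((((((hasDerivAt_id p.1).const_mul 2).mul_const (p.2 ^ 4)).sub
      (((((hasDerivAt_id p.1).pow 2).const_add 1).const_mul (3 * h)).mul_const (p.2 ^ 3))).add
      (((((hasDerivAt_id p.1).pow 3).sub (hasDerivAt_id p.1)).add
        (((hasDerivAt_id p.1).const_mul 6).mul_const (h ^ 2))).mul_const (p.2 ^ 2))).add
      ((((((hasDerivAt_id p.1).pow 2).const_mul 3).mul_const h).const_sub
        (3 * h - 2 * h ^ 3)).mul_const p.2)).add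
      (((hasDerivAt_id p.1).pow 3).sub (hasDerivAt_id p.1))
    refine (e.congr_deriv ?_).congr_of_eventuallyEq (.of_forall fun x => ?_)
    · simp [levelPolyT]; ring
    · simp [levelPoly]
  have hd : DifferentiableAt ℝ (fun p : ℝ × ℝ => levelPoly h p.1 p.2) p := by
    unfold levelPoly; fun_prop
  obtain ⟨L, hL⟩ := hd
  have l1 : L (1, 0) = levelPolyT h p.1 p.2 :=
    (HasFDerivAt.comp_hasDerivAt (f := fun x => (x, p.2)) p.1 hL
      ((hasDerivAt_id p.1).prodMk (hasDerivAt_const p.1 p.2))).unique dT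
  have l2 : L (0, 1) = levelPolyZ h p.1 p.2 :=
    (HasFDerivAt.comp_hasDerivAt (f := fun x => (p.1, x)) p.2 hL
      ((hasDerivAt_const p.2 p.1).prodMk (hasDerivAt_id p.2))).unique
      (hasDerivAt_levelPoly h p.1 p.2)
  convert hL using 1
  ext <;> simp [l1, l2]

/-- At a double root of `levelPoly` the level curve and the zero curve are tangent. -/
lemma curvesTangentAt_of_double_root {u v t : ℝ} (hv : v ∈ Ioo (0 : ℝ) (1 / 2)) (ht : t ^ 2 < 1)
    {P : ℝ × ℝ} (hP : P ∈ levelCurve u v t ∩ zeroCurve u v)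
    (hZ : levelPolyZ (1 - 2 * v) t (1 - 2 * P.2) = 0) : CurvesTangentAt u v t P := by
  have hv1 : v ∈ Ioo (0 : ℝ) 1 := ⟨hv.1, by linarith [hv.2]⟩
  have hv' := Ioo_subset_Icc_self hv1
  have hg := hP.2.2.1
  obtain ⟨-, hτ, ⟨-, hz⟩, hl⟩ := (mem_levelCurve_inter_zeroCurve hv1 ht).1 hP
  have hT : levelPolyT (1 - 2 * v) t (1 - 2 * P.2) ≠ 0 :=
    levelPolyT_ne_zero (by linarith [hv.2]) (by linarith [hv.1])
      (by nlinarith [hτ.1, hτ.2]) hz hZ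
  have hnear : ∀ᶠ R : ℝ × ℝ in 𝓝 P, R.2 ∈ Ioo (0 : ℝ) 1 :=
    continuous_snd.continuousAt.eventually (Ioo_mem_nhds hτ.1 hτ.2)
  have hq := parallelRadius_pos hτ
  have dq : DifferentiableAt ℝ (fun R : ℝ × ℝ => parallelRadius R.2) P :=
    (hasDerivAt_parallelRadius hτ).differentiableAt.comp P differentiableAt_snd
  have dc : DifferentiableAt ℝ (fun R : ℝ × ℝ => Real.cos (2 * Real.pi * (R.1 - u))) P := by
    fun_prop
  have ds : DifferentiableAt ℝ (fun R : ℝ × ℝ => Real.sin (2 * Real.pi * (R.1 - u))) P := by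
    fun_prop
  obtain ⟨D, hD⟩ : DifferentiableAt ℝ (fun R : ℝ × ℝ => lambertInner u v R.1 R.2) P := by
    unfold lambertInner; fun_prop
  have hf : HasFDerivAt (fun R : ℝ × ℝ => levelFun u v t R.1 R.2) ((-2 : ℝ) • D) P := by
    refine ((hD.const_smul (-2 : ℝ)).add_const (2 - 2 * (1 - t))).congr_of_eventuallyEq ?_
    filter_upwards [hnear] with R hR
    simp only [levelFun, sqDist_eq hv' (Ioo_subset_Icc_self hR), Pi.smul_apply, smul_eq_mul]
    ring
  -- A zero differential would make both partial derivatives vanish, which the definition of the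
  -- zero curve excludes.
  have hD0 : D ≠ 0 := by
    rintro rfl
    have hf' : HasFDerivAt (fun R : ℝ × ℝ => sqDist u v R.1 R.2) (0 : ℝ × ℝ →L[ℝ] ℝ) P := by
      rw [smul_zero] at hf
      refine (hf.add_const (2 * (1 - t))).congr_of_eventuallyEq (.of_forall fun R => ?_)
      simp [levelFun]
    have p1 : pd₁ (sqDist u v) P.1 P.2 = 0 :=
      (HasFDerivAt.comp_hasDerivAt (f := fun x => (x, P.2)) P.1 hf' ((hasDerivAt_id P.1).prodMk (hasDerivAt_const P.1 P.2))).deriv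
    have p2 : pd₂ (sqDist u v) P.1 P.2 = 0 :=
      (HasFDerivAt.comp_hasDerivAt (f := fun x => (P.1, x)) P.2 hf' ((hasDerivAt_const P.2 P.1).prodMk (hasDerivAt_id P.2))).deriv
    rw [p1, p2] at hg
    norm_num at hg
  rw [gradSq_eq hv' hτ] at hg
  have hg' : 0 < gradSq u v P.1 P.2 := lt_of_le_of_ne (by unfold gradSq; positivity) hg.symm
  have hgr := Real.rpow_pos_of_pos hg' (3 / 2)
  have dg : DifferentiableAt ℝ (fun R : ℝ × ℝ => gradSq u v R.1 R.2) P := by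
    unfold gradSq
    have hq0 := hq.ne'
    fun_prop (disch := assumption)
  have dden : DifferentiableAt ℝ (fun R : ℝ × ℝ =>
      parallelRadius R.2 ^ 4 * gradSq u v R.1 R.2 ^ (3 / 2 : ℝ)) P :=
    (dq.pow 4).mul (dg.rpow_const (.inl hg))
  have hden : parallelRadius P.2 ^ 4 * gradSq u v P.1 P.2 ^ (3 / 2 : ℝ) ≠ 0 :=
    (mul_pos (pow_pos hq 4) hgr).ne'
  obtain ⟨L, hL⟩ : DifferentiableAt ℝ (fun R : ℝ × ℝ => -(128 * Real.pi ^ 2)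
      / (parallelRadius R.2 ^ 4 * gradSq u v R.1 R.2 ^ (3 / 2 : ℝ))) P :=
    (dden.inv hden).const_mul (-(128 * Real.pi ^ 2))
  obtain ⟨E, hE⟩ : DifferentiableAt ℝ (fun R : ℝ × ℝ => 1 - 2 * R.2) P := by fun_prop
  have hlp := (hasFDerivAt_levelPoly (1 - 2 * v)
    (lambertInner u v P.1 P.2, 1 - 2 * P.2)).comp P (hD.prodMk hE)
  simp only [hl, hZ] at hlp
  set Φ : ℝ := -(128 * Real.pi ^ 2)
      / (parallelRadius P.2 ^ 4 * gradSq u v P.1 P.2 ^ (3 / 2 : ℝ)) with hΦ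
  have hΦ0 : Φ ≠ 0 := by
    have := Real.pi_pos
    rw [hΦ, neg_div, neg_ne_zero]
    positivity
  -- In the product rule the derivative of the prefactor meets the zero value of the quartic, and
  -- the z-part drops out by `hZ`; only a multiple of `D` survives.
  have hk : HasFDerivAt (fun R : ℝ × ℝ => kappa u v R.1 R.2)
      ((Φ * levelPolyT (1 - 2 * v) t (1 - 2 * P.2)) • D) P := by
    refine ((hL.mul hlp).congr_of_eventuallyEq ?_).congr_fderiv ?_
    · filter_upwards [hnear] with R hR
      rw [kappa_eq hv' hR]
      rfl
    · ext <;> simp [hl, hz, hΦ, mul_assoc]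
  have hc := mul_ne_zero hΦ0 hT
  refine ⟨_, _, hf, hk, smul_ne_zero (by norm_num) hD0, smul_ne_zero hc hD0, fun d => ?_⟩
  simp only [smul_apply, smul_eq_mul, mul_eq_zero, hc, false_or]
  norm_num

/-! ### From roots to symmetric pairs -/

lemma cos_eq_iff_fract {u α φ : ℝ} (hα : α ∈ Ico (0 : ℝ) 1) :
    Real.cos (2 * Real.pi * (α - u)) = Real.cos (2 * Real.pi * φ) ↔
      α = Int.fract (u + φ) ∨ α = Int.fract (u - φ) := by
  have hpi := Real.pi_pos.ne'
  have fr : ∀ x : ℝ, α = Int.fract x ↔ ∃ k : ℤ, x = k + α := by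
    intro x
    constructor
    · rintro rfl
      exact ⟨⌊x⌋, (Int.floor_add_fract x).symm⟩
    · rintro ⟨k, rfl⟩
      rw [Int.fract_intCast_add, Int.fract_eq_self.2 hα]
  rw [Real.cos_eq_cos_iff, fr, fr, ← exists_or]
  have k1 : ∀ k : ℤ, 2 * Real.pi * φ = 2 * k * Real.pi + 2 * Real.pi * (α - u) ↔
      u + φ = k + α := by
    intro k
    constructor
    · intro H
      have : (2 * Real.pi) * (u + φ - (k + α)) = 0 := by linarith
      linarith [(mul_eq_zero.1 this).resolve_left (by positivity)]
    · intro H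
      linear_combination (2 * Real.pi) * H
  have k2 : ∀ k : ℤ, 2 * Real.pi * φ = 2 * k * Real.pi - 2 * Real.pi * (α - u) ↔
      u - φ = ((-k : ℤ) : ℝ) + α := by
    intro k
    push_cast
    constructor
    · intro H
      have : (2 * Real.pi) * (u - φ - (-k + α)) = 0 := by linarith
      linarith [(mul_eq_zero.1 this).resolve_left (by positivity)]
    · intro H
      linear_combination (-(2 * Real.pi)) * H
  simp only [k1, k2, exists_or]
  refine or_congr_right ⟨?_, ?_⟩
  · rintro ⟨k, hk⟩; exact ⟨-k, hk⟩
  · rintro ⟨k, hk⟩; exact ⟨-k, by simpa using hk⟩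

/-- The points of the level curve at an admissible height form a symmetric pair. -/
lemma exists_symmetricPair {u v t z : ℝ} (hv : v ∈ Ioo (0 : ℝ) 1) (ht : t ^ 2 < 1)
    (hz : z ∈ levelRoots (1 - 2 * v) t) :
    ∃ P Q : ℝ × ℝ, IsSymmetricPair u P Q ∧ P.2 = (1 - z) / 2 ∧
      {R | R ∈ levelCurve u v t ∩ zeroCurve u v ∧ 1 - 2 * R.2 = z} = {P, Q} := by
  obtain ⟨hD, hP⟩ := id hz
  obtain ⟨τ, rfl⟩ : ∃ τ, z = 1 - 2 * τ := ⟨(1 - z) / 2, by ring⟩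
  have hh : (1 - 2 * v) ^ 2 < 1 := by nlinarith [hv.1, hv.2]
  -- The band condition is equivalent to (t - hz)² < (1 - h²)(1 - z²), which forces z² < 1.
  have hz1 : (1 - 2 * τ) ^ 2 < 1 := by
    nlinarith [sq_nonneg (t - (1 - 2 * v) * (1 - 2 * τ))]
  have hτ : τ ∈ Ioo (0 : ℝ) 1 := by constructor <;> nlinarith
  have hr := parallelRadius_pos hv
  have hq := parallelRadius_pos hτ
  have h1 := parallelRadius_sq (Ioo_subset_Icc_self hv)
  have h2 := parallelRadius_sq (Ioo_subset_Icc_self hτ)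
  have hrq := mul_pos hr hq
  -- The cosine that a point at this height must have for its inner product to be t; the strict band
  -- condition gives |c| < 1.
  set c := (t - (1 - 2 * v) * (1 - 2 * τ)) / (parallelRadius v * parallelRadius τ) with hc
  have hcm : parallelRadius v * parallelRadius τ * c = t - (1 - 2 * v) * (1 - 2 * τ) := by
    rw [hc]; field_simp
  have hc2 : c ^ 2 < 1 ^ 2 := by
    rw [one_pow, hc, div_pow, div_lt_one (by positivity), mul_pow, h1, h2]
    linarith
  obtain ⟨hc0, hc1⟩ := abs_lt.1 (by simpa using sq_lt_sq.1 hc2)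
  have hpi := Real.pi_pos
  set φ := Real.arccos c / (2 * Real.pi) with hφ
  have hcos : Real.cos (2 * Real.pi * φ) = c := by
    rw [hφ, mul_div_cancel₀ _ (by positivity), Real.cos_arccos hc0.le hc1.le]
  have hφ0 : 0 < φ := div_pos (Real.arccos_pos.2 hc1) (by positivity)
  have hφ1 : φ < 1 / 2 := by
    rw [hφ, div_lt_iff₀ (by positivity)]
    have : Real.arccos c < Real.pi := by
      refine lt_of_le_of_ne (Real.arccos_le_pi c) fun H => ?_
      rw [Real.arccos_eq_pi] at H
      linarith
    linarith
  have frm : ∀ x : ℝ, Int.fract x ∈ Ico (0 : ℝ) 1 := fun x =>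
    ⟨Int.fract_nonneg x, Int.fract_lt_one x⟩
  refine ⟨(Int.fract (u + φ), τ), (Int.fract (u - φ), τ),
    ⟨⟨frm _, hτ⟩, ⟨frm _, hτ⟩, ?_, ?_, rfl⟩, by ring, ?_⟩
  · intro H
    obtain ⟨k, hk⟩ := Int.fract_eq_fract.1 (congrArg Prod.fst H)
    -- The two angles differ by 2φ, which lies strictly between 0 and 1 and so is not an integer.
    have e : (k : ℝ) = 2 * φ := by linarith
    have k0 : 0 < k := by exact_mod_cast (by linarith : (0 : ℝ) < k)
    have k1 : k < 1 := by exact_mod_cast (by linarith : (k : ℝ) < 1)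
    omega
  · refine Int.fract_eq_fract.2 ⟨-⌊u + φ⌋, ?_⟩
    simp only [Int.fract]
    push_cast
    ring
  · ext ⟨α, σ⟩
    simp only [mem_ofPred_eq, mem_levelCurve_inter_zeroCurve hv ht, mem_insert_iff,
      mem_singleton_iff, Prod.mk.injEq]
    constructor
    · rintro ⟨⟨hα, -, -, hl⟩, hσ⟩
      obtain rfl : σ = τ := by linarith
      have : Real.cos (2 * Real.pi * (α - u)) = Real.cos (2 * Real.pi * φ) := by
        rw [hcos, ← mul_right_inj' hrq.ne', hcm]
        unfold lambertInner at hl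
        linarith
      rcases (cos_eq_iff_fract hα).1 this with H | H
      · exact .inl ⟨H, rfl⟩
      · exact .inr ⟨H, rfl⟩
    · intro H
      obtain ⟨hα, rfl⟩ : (α = Int.fract (u + φ) ∨ α = Int.fract (u - φ)) ∧ σ = τ := by tauto
      have hm : α ∈ Ico (0 : ℝ) 1 := by rcases hα with rfl | rfl <;> exact frm _
      refine ⟨⟨hm, hτ, hz, ?_⟩, rfl⟩
      rw [lambertInner, (cos_eq_iff_fract hm).2 hα, hcos, hcm]
      ring

/-! ### Assembly -/

theorem mainTheorem5 (u v : ℝ) (hv0 : 0 < v) (hv1 : v < 1 / 2) :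
    (∀ t : ℝ, -(1 - 2 * v) ≤ t → t ≤ 1 - 2 * v →
      ∃ P Q : ℝ × ℝ, IsSymmetricPair u P Q ∧ levelCurve u v t ∩ zeroCurve u v = {P, Q}) ∧
    (∀ t : ℝ, (-1 < t ∧ t < -(1 - 2 * v)) ∨ (1 - 2 * v < t ∧ t < 1) →
      levelCurve u v t ∩ zeroCurve u v = ∅ ∨
      (∃ P Q : ℝ × ℝ, IsSymmetricPair u P Q ∧ levelCurve u v t ∩ zeroCurve u v = {P, Q} ∧
        CurvesTangentAt u v t P ∧ CurvesTangentAt u v t Q) ∨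
      (∃ P Q P' Q' : ℝ × ℝ, IsSymmetricPair u P Q ∧ IsSymmetricPair u P' Q' ∧
        Disjoint ({P, Q} : Set (ℝ × ℝ)) {P', Q'} ∧
        levelCurve u v t ∩ zeroCurve u v = {P, Q} ∪ {P', Q'})) := by
  have hv : v ∈ Ioo (0 : ℝ) 1 := ⟨hv0, by linarith⟩
  have single : ∀ t z, t ^ 2 < 1 → levelRoots (1 - 2 * v) t = {z} →
      ∃ P Q : ℝ × ℝ, IsSymmetricPair u P Q ∧ P.2 = (1 - z) / 2 ∧
        levelCurve u v t ∩ zeroCurve u v = {P, Q} := by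
    intro t z ht hz
    obtain ⟨P, Q, hPQ, hP, hS⟩ := exists_symmetricPair (u := u) hv ht (hz ▸ mem_singleton z)
    refine ⟨P, Q, hPQ, hP, ?_⟩
    rw [← hS]
    ext R
    refine ⟨fun hR => ⟨hR, ?_⟩, fun hR => hR.1⟩
    have := ((mem_levelCurve_inter_zeroCurve hv ht).1 hR).2.2.1
    rwa [hz] at this
  constructor
  · intro t h0 h1
    obtain ⟨z, hz⟩ := levelRoots_eq_singleton (by linarith : 0 < 1 - 2 * v) (by linarith) h0 h1
    obtain ⟨P, Q, hPQ, -, hS⟩ := single t z (by nlinarith) hz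
    exact ⟨P, Q, hPQ, hS⟩
  · intro t ht
    have ht1 : t ^ 2 < 1 := by rcases ht with ⟨a, b⟩ | ⟨a, b⟩ <;> nlinarith
    rcases levelRoots_trichotomy (by linarith : 0 < 1 - 2 * v) ht with
      H | ⟨z, H, hZ⟩ | ⟨z, z', hne, H⟩
    · refine .inl (eq_empty_of_forall_notMem fun R hR => ?_)
      have := ((mem_levelCurve_inter_zeroCurve hv ht1).1 hR).2.2.1
      rwa [H] at this
    · obtain ⟨P, Q, hPQ, hP, hS⟩ := single t z ht1 H
      have hz : 1 - 2 * P.2 = z := by rw [hP]; ring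
      refine .inr (.inl ⟨P, Q, hPQ, hS, ?_, ?_⟩)
      · exact curvesTangentAt_of_double_root ⟨hv0, hv1⟩ ht1 (hS ▸ mem_insert P {Q})
          (by rw [hz, hZ])
      · exact curvesTangentAt_of_double_root ⟨hv0, hv1⟩ ht1 (hS ▸ mem_insert_of_mem P rfl)
          (by rw [hPQ.2.2.2.2, hz, hZ])
    · obtain ⟨P, Q, hPQ, hP, hS⟩ := exists_symmetricPair (u := u) (z := z) hv ht1 (by simp [H])
      obtain ⟨P', Q', hPQ', hP', hS'⟩ :=
        exists_symmetricPair (u := u) (z := z') hv ht1 (by simp [H])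
      refine .inr (.inr ⟨P, Q, P', Q', hPQ, hPQ', ?_, ?_⟩)
      · rw [← hS, ← hS', disjoint_left]
        rintro R ⟨-, a⟩ ⟨-, b⟩
        exact hne (a.symm.trans b)
      · rw [← hS, ← hS']
        ext R
        refine ⟨fun hR => ?_, fun hR => hR.elim And.left And.left⟩
        have := ((mem_levelCurve_inter_zeroCurve hv ht1).1 hR).2.2.1
        rw [H] at this
        exact this.imp (fun e => ⟨hR, e⟩) (fun e => ⟨hR, e⟩)
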